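/- Fix a universal machine $U$: a partial computable map from binary strings to binary strings such that for every partial computable map $M$ from binary strings to binary strings there are a computable function $t$ and a constant $c_M$ with $U(t(p)) = M(p)$ and $|t(p)| \le |p| + c_M$ for all strings $p$. Let $C(x) = \min\{|p| : U(p) = x\}$ be the Kolmogorov complexity of $x$. There exists a computable function $f$ that, on input $x \in \{0,1\}^*$ and a rational number $\delta > 0$, returns a list of strings of length $|x|$, nonempty whenever $x$ is nonempty, with the following properties: (1) There is a polynomial $P$, independent of $x$ and $\delta$, such that the size of the list is at most $|x| \cdot P(1/\delta)$; that is, the size is $O(|x|)\,\mathrm{poly}(1/\delta)$. (2) For every rational $\delta > 0$ there is a constant $c_\delta$ such that for every $x$ with $C(x) < |x| - \log_2 |x| - c_\delta$, at least a $(1-\delta)$ fraction of the elements of the list $f(x,\delta)$ (counted with multiplicity) have Kolmogorov complexity larger than $C(x)$. -/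

import Mathlib

/-- A (string-to-string) machine: a partial function on binary strings. The machines of interest
are the partial computable ones (`Partrec`). -/
abbrev Machine : Type := List Bool →. List Bool

/-- `U` is a universal (optimal) machine: it is partial computable, and every partial computable
`M` is simulated by `U` through a total computable translator `t` that lengthens programs by at
most an additive constant. The equation `U (t p) = M p` is an equation of partial values: both
sides diverge, or both converge to the same string. -/
def IsUniversal (U : Machine) : Prop :=
  Partrec U ∧
    ∀ M : Machine, Partrec M →
      ∃ t : List Bool → List Bool, Computable t ∧
        (∀ p, U (t p) = M p) ∧
        ∃ c : ℕ, ∀ p, (t p).length ≤ p.length + c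

/-- The Kolmogorov complexity of `x` with respect to `U`: the length of a shortest program for
`x`. When `U` is universal, every `x` has a program, so the infimum is a minimum. -/
noncomputable def kolmogorov (U : Machine) (x : List Bool) : ℕ :=
  sInf {k : ℕ | ∃ p : List Bool, x ∈ U p ∧ p.length = k}

/-- The minimum in the definition of complexity is attained. -/
theorem IsUniversal.exists_shortest {U : Machine} (hU : IsUniversal U) (x : List Bool) :
    ∃ p : List Bool, x ∈ U p ∧ p.length = kolmogorov U x := by
  obtain ⟨t, -, ht, -⟩ := hU.2 (fun _ => Part.some x) (Computable.const x)
  exact Nat.sInf_mem (s := {k : ℕ | ∃ p : List Bool, x ∈ U p ∧ p.length = k})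
    ⟨_, t [], by rw [ht]; exact Part.mem_some x, rfl⟩

/-- A function of a binary string and a nonnegative rational number with values in lists of
binary strings is computable: its value at `(x, a / b)` is computable from `x` and the natural
numbers `a`, `b`. -/
def ComputableListFunction (f : List Bool → ℚ → List (List Bool)) : Prop :=
  Computable fun q : List Bool × ℕ × ℕ => f q.1 ((q.2.1 : ℚ) / (q.2.2 : ℚ))

/-! The list consists of the translates `x + a` in the cube of dimension n = |x|, with `a` running
over a small-bias multiset `A` of 2(n+1)L² points. Averaging over these translates is diagonal in
the Walsh basis, with all nontrivial eigenvalues at most 1/L in absolute value. Hence a set B of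
density at most 1/(2m) receives a proportion 1/m of the translates of at most 4m²|B|/L² points
(`IsBalanced.card_mul_sq_le`). Such an `A` exists by a potential-function argument
(`exists_isBalanced`) and is found by search.

Let B be the set of strings of complexity at most k, so |B| ≤ 2^(k+1), and let L = 2^(d+2)(m+1)².
Call a string bad for (d, k) if, for some m meeting the density condition, a proportion 1/(m+1) of
its translates lies in B. The factor (m+1)² in L makes the count summable over m: at most 2^k/4^d
strings are bad (`IsCodeOf.card_mul_le`), so one d serves every δ.

Bad strings can be enumerated from (d, k), so each is given by an index of exactly k - 2d bits. The
prefix 1^d 0 announces d, and k is recovered from the length of the index. A bad string of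
complexity k would thus have complexity at most k - d + O(1), which is absurd for large d
(`IsUniversal.exists_translations`). The theorem follows with m = ⌊1/δ⌋. -/

/-! ### Walsh functions on the Boolean cube -/

/-- The pointwise exclusive or of two points of the Boolean cube. -/
def cubeXor {n : ℕ} (x y : Fin n → Bool) : Fin n → Bool := fun i => xor (x i) (y i)

/-- The Walsh function with frequency `c`, a character of the Boolean cube. -/
noncomputable def walsh {n : ℕ} (c x : Fin n → Bool) : ℝ :=
  ∏ i, if (c i && x i) = true then -1 else 1

theorem walsh_cubeXor {n : ℕ} (c x y : Fin n → Bool) :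
    walsh c (cubeXor x y) = walsh c x * walsh c y := by
  unfold walsh cubeXor
  rw [← Finset.prod_mul_distrib]
  refine Finset.prod_congr rfl fun i _ => ?_
  cases c i <;> cases x i <;> cases y i <;> simp

theorem walsh_comm {n : ℕ} (c x : Fin n → Bool) : walsh c x = walsh x c := by
  unfold walsh
  exact Finset.prod_congr rfl fun i _ => by rw [Bool.and_comm]

theorem walsh_false {n : ℕ} (x : Fin n → Bool) : walsh (fun _ => false) x = 1 := by
  simp [walsh]

theorem walsh_eq_or {n : ℕ} (c x : Fin n → Bool) : walsh c x = 1 ∨ walsh c x = -1 := by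
  unfold walsh
  refine Finset.prod_induction _ (fun r : ℝ => r = 1 ∨ r = -1) ?_ (Or.inl rfl) ?_
  · rintro a b (rfl | rfl) (rfl | rfl) <;> norm_num
  · intro i _
    split_ifs <;> simp

/-- The sum factors over coordinates, and a coordinate where `c` is true contributes 1 + (-1) = 0.
-/
theorem sum_walsh {n : ℕ} (c : Fin n → Bool) (hc : c ≠ fun _ => false) :
    ∑ x, walsh c x = 0 := by
  obtain ⟨i, hi⟩ := Function.ne_iff.1 hc
  have h := Finset.prod_univ_sum (fun _ : Fin n => (Finset.univ : Finset Bool))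
    (fun i b => if (c i && b) = true then (-1 : ℝ) else 1)
  rw [Fintype.piFinset_univ] at h
  unfold walsh
  rw [← h]
  refine Finset.prod_eq_zero (Finset.mem_univ i) ?_
  simp at hi
  simp [hi]

theorem cubeXor_self_left {n : ℕ} (a x : Fin n → Bool) : cubeXor (cubeXor x a) a = x := by
  funext i; simp [cubeXor]

theorem cubeXor_eq_false_iff {n : ℕ} (x y : Fin n → Bool) :
    cubeXor x y = (fun _ => false) ↔ x = y := by
  simp [cubeXor, funext_iff]

/-- Translation by `a` as a permutation of the cube. -/
def cubeTranslate {n : ℕ} (a : Fin n → Bool) : Equiv.Perm (Fin n → Bool) where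
  toFun x := cubeXor x a
  invFun x := cubeXor x a
  left_inv x := cubeXor_self_left a x
  right_inv x := cubeXor_self_left a x

theorem sum_cubeXor {n : ℕ} (a : Fin n → Bool) (f : (Fin n → Bool) → ℝ) :
    ∑ x, f (cubeXor x a) = ∑ x, f x :=
  Equiv.sum_comp (cubeTranslate a) f

theorem sum_walsh_mul_walsh {n : ℕ} (x y : Fin n → Bool) :
    ∑ c, walsh c x * walsh c y = if x = y then (2 : ℝ) ^ n else 0 := by
  simp_rw [← walsh_cubeXor, walsh_comm _ (cubeXor x y)]
  split_ifs with h
  · rw [(cubeXor_eq_false_iff x y).2 h]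
    simp [walsh_false]
  · exact sum_walsh _ (mt (cubeXor_eq_false_iff x y).1 h)

/-- The unnormalised Walsh transform. -/
noncomputable def walshTransform {n : ℕ} (f : (Fin n → Bool) → ℝ) (c : Fin n → Bool) : ℝ :=
  ∑ x, f x * walsh c x

/-- Parseval's identity: expand the square and use orthogonality of the Walsh functions. -/
theorem sum_walshTransform_sq {n : ℕ} (f : (Fin n → Bool) → ℝ) :
    ∑ c, walshTransform f c ^ 2 = 2 ^ n * ∑ x, f x ^ 2 := by
  have h : ∀ c, walshTransform f c ^ 2 =
      ∑ x, ∑ y, f x * f y * (walsh c x * walsh c y) := by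
    intro c
    rw [walshTransform, sq, Finset.sum_mul_sum]
    exact Finset.sum_congr rfl fun x _ => Finset.sum_congr rfl fun y _ => by ring
  simp_rw [h]
  rw [Finset.sum_comm]
  simp_rw [Finset.sum_comm (s := Finset.univ (α := Fin n → Bool)) (t := Finset.univ)
    (f := fun c y => f _ * f y * (walsh c _ * walsh c y))]
  simp_rw [← Finset.mul_sum, sum_walsh_mul_walsh]
  rw [Finset.mul_sum]
  refine Finset.sum_congr rfl fun x _ => ?_
  simp
  ring

/-- The sum of `f` over the translates of `x` by the members of a list. -/
noncomputable def translateSum {n : ℕ} (A : List (Fin n → Bool)) (f : (Fin n → Bool) → ℝ)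
    (x : Fin n → Bool) : ℝ :=
  (A.map fun a => f (cubeXor x a)).sum

/-- Characters are eigenvectors of translations, so the Walsh sums of `A` are the eigenvalues of the
operator `translateSum A`. -/
theorem walshTransform_translateSum {n : ℕ} (A : List (Fin n → Bool)) (f : (Fin n → Bool) → ℝ)
    (c : Fin n → Bool) :
    walshTransform (translateSum A f) c = (A.map (walsh c)).sum * walshTransform f c := by
  induction A with
  | nil => simp [walshTransform, translateSum]
  | cons a A ih =>
    rw [List.map_cons, List.sum_cons, add_mul, ← ih]
    simp only [walshTransform, translateSum, List.map_cons, List.sum_cons, add_mul,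
      Finset.sum_add_distrib, add_left_inj]
    rw [← sum_cubeXor a, Finset.mul_sum]
    refine Finset.sum_congr rfl fun x _ => ?_
    rw [cubeXor_self_left, walsh_cubeXor]
    ring

/-- All nontrivial Walsh sums of the list `A` are at most `1 / L` of its length. -/
def IsBalanced {n : ℕ} (L : ℕ) (A : List (Fin n → Bool)) : Prop :=
  ∀ c : Fin n → Bool, (c ≠ fun _ => false) → |(A.map (walsh c)).sum| * L ≤ A.length

/-- The spectral gap: a function of mean zero has no component at the trivial frequency, and every
other component is multiplied by at most |A|/L in absolute value. -/
theorem IsBalanced.sum_translateSum_sq_le {n L : ℕ} {A : List (Fin n → Bool)}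
    (hA : IsBalanced L A) (f : (Fin n → Bool) → ℝ) (hf : ∑ x, f x = 0) :
    (∑ x, translateSum A f x ^ 2) * (L : ℝ) ^ 2 ≤ (A.length : ℝ) ^ 2 * ∑ x, f x ^ 2 := by
  have h2 : (0 : ℝ) < 2 ^ n := by positivity
  refine le_of_mul_le_mul_left ?_ h2
  rw [← mul_assoc, ← sum_walshTransform_sq,
    show (2 : ℝ) ^ n * ((A.length : ℝ) ^ 2 * ∑ x, f x ^ 2) =
      (A.length : ℝ) ^ 2 * (2 ^ n * ∑ x, f x ^ 2) by ring, ← sum_walshTransform_sq,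
    Finset.sum_mul, Finset.mul_sum]
  refine Finset.sum_le_sum fun c _ => ?_
  rw [walshTransform_translateSum]
  by_cases hc : c = fun _ => false
  · have : walshTransform f c = 0 := by simp [walshTransform, hc, walsh_false, hf]
    simp [this]
  · have h1 := hA c hc
    have h3 : ((A.map (walsh c)).sum) ^ 2 * (L : ℝ) ^ 2 ≤ (A.length : ℝ) ^ 2 := by
      rw [← sq_abs, ← mul_pow]
      exact pow_le_pow_left₀ (by positivity) h1 2
    nlinarith [mul_le_mul_of_nonneg_right h3 (sq_nonneg (walshTransform f c))]

theorem translateSum_sub_const {n : ℕ} (A : List (Fin n → Bool)) (f : (Fin n → Bool) → ℝ) (r : ℝ)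
    (x : Fin n → Bool) :
    translateSum A (fun y => f y - r) x = translateSum A f x - A.length * r := by
  induction A with
  | nil => simp [translateSum]
  | cons a A ih =>
    simp only [translateSum, List.map_cons, List.sum_cons, List.length_cons] at ih ⊢
    rw [ih]; push_cast; ring

theorem translateSum_indicator {n : ℕ} (A : List (Fin n → Bool)) (B : Finset (Fin n → Bool))
    (x : Fin n → Bool) :
    translateSum A (fun y => if y ∈ B then 1 else 0) x =
      (A.countP fun a => decide (cubeXor x a ∈ B) : ℕ) := by
  induction A with
  | nil => simp [translateSum]
  | cons a A ih =>
    simp only [translateSum, List.map_cons, List.sum_cons, List.countP_cons] at ih ⊢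
    rw [ih]; push_cast; simp [add_comm]

/-- Few points of the cube have a proportion `1 / m` of their translates in a sparse set. -/
theorem IsBalanced.card_mul_sq_le {n L m : ℕ} {A : List (Fin n → Bool)} (hA : IsBalanced L A)
    (hA0 : A ≠ []) (hm : 0 < m) (B S : Finset (Fin n → Bool)) (hB : B.card * (2 * m) ≤ 2 ^ n)
    (hS : ∀ x ∈ S, A.length ≤ m * A.countP fun a => decide (cubeXor x a ∈ B)) :
    S.card * L ^ 2 ≤ 4 * m ^ 2 * B.card := by
  have hD : (0 : ℝ) < A.length := by exact_mod_cast List.length_pos_iff.2 hA0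
  have h2 : (0 : ℝ) < 2 ^ n := by positivity
  have hm' : (0 : ℝ) < m := by exact_mod_cast hm
  set r : ℝ := B.card / 2 ^ n with hr
  set e : (Fin n → Bool) → ℝ := fun y => if y ∈ B then 1 else 0 with he
  have hr0 : 0 ≤ r := by positivity
  have hsum : ∑ y, e y = B.card := by simp [he]
  have hrn : 2 ^ n * r = B.card := by rw [hr]; field_simp
  -- The density of `B` is at most 1/(2m), so centring the indicator costs at most half of the
  -- proportion 1/m. This is the source of the factor 4 m².
  have hr2 : r * (2 * m) ≤ 1 := by
    rw [hr, div_mul_eq_mul_div, div_le_one h2]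
    exact_mod_cast hB
  have hf : ∑ y, (e y - r) = 0 := by
    rw [Finset.sum_sub_distrib, hsum]
    simp [hrn]
  have hsq : ∑ y, (e y - r) ^ 2 ≤ B.card := by
    have : ∀ y, (e y - r) ^ 2 = (1 - 2 * r) * e y + r ^ 2 := by
      intro y
      by_cases hy : y ∈ B
      · simp only [he, hy, if_true]; ring
      · simp [he, hy]
    simp_rw [this]
    rw [Finset.sum_add_distrib, ← Finset.mul_sum, hsum]
    simp only [Finset.sum_const, Finset.card_univ, Fintype.card_pi, Fintype.card_bool,
      Finset.prod_const, Fintype.card_fin, nsmul_eq_mul, Nat.cast_pow, Nat.cast_ofNat]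
    nlinarith
  have key := hA.sum_translateSum_sq_le _ hf
  -- Chebyshev's argument: every point of `S` contributes at least (|A|/(2m))² to the second moment.
  have hlow : ∀ x ∈ S, (A.length : ℝ) ^ 2 ≤ 4 * m ^ 2 * translateSum A (fun y => e y - r) x ^ 2 := by
    intro x hx
    have h1 : (A.length : ℝ) ≤ m * translateSum A e x := by
      rw [translateSum_indicator]
      exact_mod_cast hS x hx
    have h3 : (A.length : ℝ) ≤ 2 * m * translateSum A (fun y => e y - r) x := by
      rw [translateSum_sub_const]
      nlinarith
    calc (A.length : ℝ) ^ 2 ≤ (2 * m * translateSum A (fun y => e y - r) x) ^ 2 :=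
          pow_le_pow_left₀ hD.le h3 2
      _ = _ := by ring
  have hSsum : (S.card : ℝ) * (A.length : ℝ) ^ 2 ≤
      4 * m ^ 2 * ∑ x, translateSum A (fun y => e y - r) x ^ 2 := by
    calc (S.card : ℝ) * (A.length : ℝ) ^ 2 = ∑ x ∈ S, (A.length : ℝ) ^ 2 := by simp
      _ ≤ ∑ x ∈ S, 4 * m ^ 2 * translateSum A (fun y => e y - r) x ^ 2 := Finset.sum_le_sum hlow
      _ ≤ ∑ x, 4 * m ^ 2 * translateSum A (fun y => e y - r) x ^ 2 :=
          Finset.sum_le_sum_of_subset_of_nonneg (Finset.subset_univ _) fun _ _ _ => by positivity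
      _ = _ := by rw [Finset.mul_sum]
  have hfin : ((S.card : ℝ) * L ^ 2) * (A.length : ℝ) ^ 2 ≤
      (4 * m ^ 2 * B.card) * (A.length : ℝ) ^ 2 := by
    calc ((S.card : ℝ) * L ^ 2) * (A.length : ℝ) ^ 2
        = (S.card : ℝ) * (A.length : ℝ) ^ 2 * L ^ 2 := by ring
      _ ≤ 4 * m ^ 2 * (∑ x, translateSum A (fun y => e y - r) x ^ 2) * L ^ 2 := by gcongr
      _ = 4 * m ^ 2 * ((∑ x, translateSum A (fun y => e y - r) x ^ 2) * L ^ 2) := by ring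
      _ ≤ 4 * m ^ 2 * ((A.length : ℝ) ^ 2 * ∑ x, (e x - r) ^ 2) := by gcongr
      _ ≤ 4 * m ^ 2 * ((A.length : ℝ) ^ 2 * B.card) := by gcongr
      _ = _ := by ring
  exact_mod_cast le_of_mul_le_mul_right hfin (by positivity)

/-! ### Existence of balanced lists -/

/-- A Chernoff bound by conditional expectations. Appending `a` changes each Walsh sum by ±1;
averaged over `a`, the sinh term of the addition formula vanishes and each cosh is multiplied by
cosh t. Some `a` does no worse than the average. -/
theorem exists_sum_cosh_le (n : ℕ) (t : ℝ) (D : ℕ) :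
    ∃ A : List (Fin n → Bool), A.length = D ∧
      ∑ c ∈ Finset.univ.erase (fun _ => false), Real.cosh (t * (A.map (walsh c)).sum) ≤
        2 ^ n * Real.cosh t ^ D := by
  induction D with
  | zero =>
    refine ⟨[], rfl, ?_⟩
    simp
  | succ D ih =>
    obtain ⟨A, hA, hs⟩ := ih
    have havg : ∑ a : Fin n → Bool, ∑ c ∈ Finset.univ.erase (fun _ => false),
        Real.cosh (t * ((a :: A).map (walsh c)).sum) =
        ∑ _a : Fin n → Bool, Real.cosh t *
          ∑ c ∈ Finset.univ.erase (fun _ => false), Real.cosh (t * (A.map (walsh c)).sum) := by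
      rw [Finset.sum_comm, Finset.sum_const, Finset.mul_sum, Finset.smul_sum]
      refine Finset.sum_congr rfl fun c hc => ?_
      have h : ∀ a, Real.cosh (t * ((a :: A).map (walsh c)).sum) =
          Real.cosh t * Real.cosh (t * (A.map (walsh c)).sum) +
            walsh c a * (Real.sinh t * Real.sinh (t * (A.map (walsh c)).sum)) := by
        intro a
        rw [List.map_cons, List.sum_cons, mul_add, Real.cosh_add]
        rcases walsh_eq_or c a with h | h <;> simp [h]
      simp_rw [h]
      rw [Finset.sum_add_distrib, ← Finset.sum_mul (f := walsh c),
        sum_walsh c (Finset.ne_of_mem_erase hc)]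
      simp
    obtain ⟨a, -, ha⟩ := Finset.exists_le_of_sum_le Finset.univ_nonempty havg.le
    refine ⟨a :: A, by simp [hA], ha.trans ?_⟩
    calc _ ≤ Real.cosh t * (2 ^ n * Real.cosh t ^ D) := by
          gcongr
      _ = _ := by ring

theorem exists_isBalanced (n L : ℕ) (hL : 0 < L) :
    ∃ A : List (Fin n → Bool), A.length = 2 * (n + 1) * L ^ 2 ∧ IsBalanced L A := by
  have hL' : (0 : ℝ) < L := by exact_mod_cast hL
  -- With t = 1/L and D = 2(n+1)L², cosh t ≤ exp(t²/2) bounds the potential by 2^n e^(n+1). A single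
  -- violated frequency would already contribute more than e^(2(n+1))/2, which is at least as large
  -- because 2 ≤ e.
  obtain ⟨A, hA, hs⟩ := exists_sum_cosh_le n (1 / L) (2 * (n + 1) * L ^ 2)
  refine ⟨A, hA, fun c hc => ?_⟩
  by_contra! hlt
  set s := (A.map (walsh c)).sum
  have h1 : (2 * (n + 1) : ℝ) < |1 / L * s| := by
    rw [hA] at hlt
    push_cast at hlt
    rw [abs_mul, abs_of_pos (by positivity : (0 : ℝ) < 1 / L), one_div, ← div_eq_inv_mul,
      lt_div_iff₀ hL']
    nlinarith
  have h2 : Real.cosh (1 / L * s) ≤ 2 ^ n * Real.cosh (1 / L) ^ (2 * (n + 1) * L ^ 2) := by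
    refine le_trans ?_ hs
    exact Finset.single_le_sum (f := fun c => Real.cosh (1 / L * (A.map (walsh c)).sum))
      (fun _ _ => (Real.cosh_pos _).le) (by simp [hc])
  have h3 : Real.exp (2 * (n + 1)) / 2 < Real.cosh (1 / L * s) := by
    rw [← Real.cosh_abs, Real.cosh_eq]
    have := Real.exp_lt_exp.2 h1
    have := Real.exp_pos (-|1 / L * s|)
    linarith
  have h4 : Real.cosh (1 / L) ^ (2 * (n + 1) * L ^ 2) ≤ Real.exp (n + 1) := by
    calc Real.cosh (1 / L) ^ (2 * (n + 1) * L ^ 2)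
        ≤ Real.exp ((1 / L) ^ 2 / 2) ^ (2 * (n + 1) * L ^ 2) := by
          gcongr
          exact Real.cosh_le_exp_half_sq _
      _ = Real.exp (n + 1) := by
          rw [← Real.exp_nat_mul]
          congr 1
          push_cast
          field_simp
  have h5 : (2 : ℝ) ^ (n + 1) ≤ Real.exp (n + 1) := by
    have : (2 : ℝ) ≤ Real.exp 1 := by linarith [Real.add_one_le_exp 1]
    calc (2 : ℝ) ^ (n + 1) ≤ Real.exp 1 ^ (n + 1) := by gcongr
      _ = Real.exp (n + 1) := by rw [← Real.exp_nat_mul]; simp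
  have h6 : Real.exp (2 * (n + 1)) = Real.exp (n + 1) * Real.exp (n + 1) := by
    rw [← Real.exp_add]; ring_nf
  have h7 : Real.exp (2 * (n + 1)) / 2 < 2 ^ n * Real.exp (n + 1) :=
    h3.trans_le (h2.trans (by gcongr))
  rw [h6] at h7
  rw [pow_succ] at h5
  nlinarith [Real.exp_pos ((n : ℝ) + 1)]

/-! ### Binary strings as points of the cube -/

/-- All binary strings of length `n`. -/
def binaryStrings (n : ℕ) : List (List Bool) :=
  Nat.rec [[]] (fun _ l => l.map (List.cons true) ++ l.map (List.cons false)) n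

theorem mem_binaryStrings {n : ℕ} {x : List Bool} : x ∈ binaryStrings n ↔ x.length = n := by
  induction n generalizing x with
  | zero => simp [binaryStrings]
  | succ n ih =>
    have h : binaryStrings (n + 1) = (binaryStrings n).map (List.cons true) ++
      (binaryStrings n).map (List.cons false) := rfl
    rw [h]
    cases x with
    | nil => simp
    | cons b x => cases b <;> simp [ih]

theorem length_binaryStrings (n : ℕ) : (binaryStrings n).length = 2 ^ n := by
  induction n with
  | zero => simp [binaryStrings]
  | succ n ih =>
    have h : binaryStrings (n + 1) = (binaryStrings n).map (List.cons true) ++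
      (binaryStrings n).map (List.cons false) := rfl
    rw [h]
    simp [ih]
    omega

/-- The bitwise exclusive or of the first `n` bits of two strings. -/
def xorString (n : ℕ) (x a : List Bool) : List Bool :=
  (List.range n).map fun i => xor (x.getD i false) (a.getD i false)

/-- The number of positions below `n` at which both strings have the bit `true`. -/
def commonOnes (n : ℕ) (c a : List Bool) : ℕ :=
  ((List.range n).filter fun i => (c.getD i false && a.getD i false) = true).length

/-- The first `n` bits of a string as a point of the cube. -/
def toCube (n : ℕ) (x : List Bool) : Fin n → Bool := fun i => x.getD i false

theorem length_xorString (n : ℕ) (x a : List Bool) : (xorString n x a).length = n := by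
  simp [xorString]

theorem toCube_ofFn {n : ℕ} (c : Fin n → Bool) : toCube n (List.ofFn c) = c := by
  funext i; simp [toCube]

theorem toCube_xorString (n : ℕ) (x a : List Bool) :
    toCube n (xorString n x a) = cubeXor (toCube n x) (toCube n a) := by
  funext i; simp [toCube, xorString, cubeXor]

theorem toCube_injOn {n : ℕ} {x y : List Bool} (hx : x.length = n) (hy : y.length = n)
    (h : toCube n x = toCube n y) : x = y := by
  refine List.ext_getElem (hx.trans hy.symm) fun i h1 h2 => ?_
  have := congrFun h ⟨i, hx ▸ h1⟩
  simpa [toCube, h1, h2] using this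

theorem walsh_toCube (n : ℕ) (c a : List Bool) :
    walsh (toCube n c) (toCube n a) = (-1) ^ commonOnes n c a := by
  unfold walsh toCube
  rw [Fin.prod_univ_eq_prod_range (fun i => if (c.getD i false && a.getD i false) = true
    then (-1 : ℝ) else 1) n]
  unfold commonOnes
  induction n with
  | zero => simp
  | succ n ih =>
    rw [Finset.prod_range_succ, ih, List.range_succ, List.filter_append, List.length_append,
      pow_add]
    congr 1
    by_cases h : (c.getD n false && a.getD n false) = true
    · rw [if_pos h, List.filter_cons_of_pos (by simpa using h)]
      simp
    · rw [if_neg h, List.filter_cons_of_neg (by simpa using h)]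
      simp

theorem sum_walsh_toCube (n : ℕ) (c : List Bool) (A : List (List Bool)) :
    ((A.map (toCube n)).map (walsh (toCube n c))).sum =
      A.length - 2 * ((A.filter fun a => commonOnes n c a % 2 = 1).length : ℝ) := by
  induction A with
  | nil => simp
  | cons a A ih =>
    rw [List.map_cons, List.map_cons, List.sum_cons, ih, walsh_toCube]
    rcases Nat.mod_two_eq_zero_or_one (commonOnes n c a) with h | h
    · rw [(Nat.even_iff.2 h).neg_one_pow, List.filter_cons_of_neg (by simp [h])]
      simp only [List.length_cons]; push_cast; ring
    · rw [(Nat.odd_iff.2 h).neg_one_pow, List.filter_cons_of_pos (by simp [h])]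
      simp only [List.length_cons]; push_cast; ring

/-- An arithmetical form of balancedness for lists of strings, for a fixed frequency. -/
def BalancedAt (n L : ℕ) (A : List (List Bool)) (c : List Bool) : Prop :=
  L * A.length ≤ L * (2 * (A.filter fun a => commonOnes n c a % 2 = 1).length) + A.length ∧
  L * (2 * (A.filter fun a => commonOnes n c a % 2 = 1).length) ≤ L * A.length + A.length

instance (n L : ℕ) (A : List (List Bool)) (c : List Bool) : Decidable (BalancedAt n L A c) :=
  inferInstanceAs (Decidable (_ ∧ _))

/-- Connects the real Walsh sums with a condition on natural numbers that can be tested. The two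
inequalities are the two sides of the absolute value, arranged to avoid subtraction. -/
theorem balancedAt_iff (n L : ℕ) (A : List (List Bool)) (c : List Bool) :
    BalancedAt n L A c ↔
      |((A.map (toCube n)).map (walsh (toCube n c))).sum| * L ≤ (A.map (toCube n)).length := by
  rw [sum_walsh_toCube, List.length_map]
  unfold BalancedAt
  set t := (A.filter fun a => commonOnes n c a % 2 = 1).length
  rw [← abs_of_nonneg (Nat.cast_nonneg L : (0 : ℝ) ≤ L), ← abs_mul, abs_le]
  rify
  constructor <;> rintro ⟨h1, h2⟩ <;> constructor <;> linarith

/-- `A` is a list of the prescribed length, balanced at every nonzero frequency. -/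
def BalancedList (n L : ℕ) (A : List (List Bool)) : Prop :=
  A.length = 2 * (n + 1) * L ^ 2 ∧
    ∀ c ∈ binaryStrings n, (∃ b ∈ c, b = true) → BalancedAt n L A c

instance (n L : ℕ) (A : List (List Bool)) : Decidable (BalancedList n L A) :=
  inferInstanceAs (Decidable (_ ∧ _))

theorem toCube_eq_false_iff {n : ℕ} {c : List Bool} (hc : c.length = n) :
    toCube n c = (fun _ => false) ↔ ¬ ∃ b ∈ c, b = true := by
  subst hc
  simp only [exists_eq_right, List.mem_iff_getElem, not_exists, funext_iff, toCube]
  constructor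
  · intro h i hi
    have := h ⟨i, hi⟩
    simpa [hi] using this
  · intro h i
    simpa using h i i.2

theorem BalancedList.isBalanced {n L : ℕ} {A : List (List Bool)} (hA : BalancedList n L A) :
    IsBalanced L (A.map (toCube n)) := by
  intro c hc
  rw [← toCube_ofFn c] at hc ⊢
  rw [← balancedAt_iff]
  refine hA.2 _ (mem_binaryStrings.2 (by simp)) ?_
  exact not_not.1 (mt (toCube_eq_false_iff (by simp)).2 hc)

theorem exists_balancedList (n L : ℕ) : ∃ A : List (List Bool), BalancedList n L A := by
  -- For L = 0 the prescribed length is 0 and the empty list qualifies; the search for a balanced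
  -- list thus terminates on every input.
  rcases Nat.eq_zero_or_pos L with rfl | hL
  · exact ⟨[], by simp, fun c _ _ => by simp [BalancedAt]⟩
  obtain ⟨A, hA, hb⟩ := exists_isBalanced n L hL
  refine ⟨A.map List.ofFn, by simpa using hA, fun c hc h1 => ?_⟩
  have hid : (A.map List.ofFn).map (toCube n) = A := by
    rw [List.map_map, show toCube n ∘ List.ofFn = id from funext toCube_ofFn, List.map_id]
  rw [balancedAt_iff, hid]
  refine hb _ fun h => ?_
  exact (toCube_eq_false_iff (mem_binaryStrings.1 hc)).1 h h1

/-- Few strings of length `n` have a proportion `1 / m` of their translates in a sparse set. -/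
theorem BalancedList.card_mul_sq_le {n L m : ℕ} {A : List (List Bool)} (hA : BalancedList n L A)
    (hL : 0 < L) (hm : 0 < m) (B S : Finset (List Bool)) (hB : B.card * (2 * m) ≤ 2 ^ n)
    (hBn : ∀ y ∈ B, y.length = n) (hSn : ∀ x ∈ S, x.length = n)
    (hS : ∀ x ∈ S, A.length ≤ m * (A.filter fun a => xorString n x a ∈ B).length) :
    S.card * L ^ 2 ≤ 4 * m ^ 2 * B.card := by
  classical
  have hinj : ∀ T : Finset (List Bool), (∀ x ∈ T, x.length = n) →
      (T.image (toCube n)).card = T.card := fun T hT =>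
    Finset.card_image_of_injOn fun x hx y hy h => toCube_injOn (hT x hx) (hT y hy) h
  have hA0 : A.map (toCube n) ≠ [] := by
    intro h
    have h1 := congrArg List.length h
    rw [List.length_map, hA.1, List.length_nil] at h1
    have : 0 < 2 * (n + 1) * L ^ 2 := by positivity
    omega
  rw [← hinj S hSn, ← hinj B hBn]
  refine hA.isBalanced.card_mul_sq_le hA0 hm _ _ (by rwa [hinj B hBn]) fun x hx => ?_
  obtain ⟨x, hxS, rfl⟩ := Finset.mem_image.1 hx
  rw [List.length_map, List.countP_map]
  refine (hS x hxS).trans_eq ?_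
  rw [← List.countP_eq_length_filter]
  congr 1
  refine List.countP_congr fun a _ => ?_
  simp only [Function.comp, decide_eq_true_eq, ← toCube_xorString]
  constructor
  · exact fun h => Finset.mem_image_of_mem _ h
  · intro h
    obtain ⟨y, hy, hxy⟩ := Finset.mem_image.1 h
    rwa [← toCube_injOn (hBn y hy) (length_xorString n x a) hxy]

/-! ### Computability of a balanced list -/

theorem Primrec.filter_length {α β : Type*} [Primcodable α] [Primcodable β] {f : α → List β}
    {p : α → β → Prop} [∀ a, DecidablePred (p a)] (hf : Primrec f)
    (hp : PrimrecPred fun q : α × β => p q.1 q.2) :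
    Primrec fun a => ((f a).filter fun b => p a b).length := by
  have hr : PrimrecRel fun (b : β) (a : α) => p a b :=
    hp.comp (Primrec.pair Primrec.snd Primrec.fst)
  have : DecidableRel fun (b : β) (a : α) => p a b := fun b a => inferInstance
  exact (Primrec.list_length.comp (hr.listFilter.comp hf Primrec.id)).of_eq fun a => by
    simp only [id]; congr!

theorem PrimrecPred.forall_mem {α β : Type*} [Primcodable α] [Primcodable β] {f : α → List β}
    {p : α → β → Prop} (hf : Primrec f) (hp : PrimrecPred fun q : α × β => p q.1 q.2) :
    PrimrecPred fun a => ∀ b ∈ f a, p a b := by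
  have hr : PrimrecRel fun (b : β) (a : α) => p a b :=
    hp.comp (Primrec.pair Primrec.snd Primrec.fst)
  exact hr.forall_mem_list.comp hf Primrec.id

theorem PrimrecPred.exists_mem {α β : Type*} [Primcodable α] [Primcodable β] {f : α → List β}
    {p : α → β → Prop} (hf : Primrec f) (hp : PrimrecPred fun q : α × β => p q.1 q.2) :
    PrimrecPred fun a => ∃ b ∈ f a, p a b := by
  have hr : PrimrecRel fun (b : β) (a : α) => p a b :=
    hp.comp (Primrec.pair Primrec.snd Primrec.fst)
  exact hr.exists_mem_list.comp hf Primrec.id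

theorem primrec_nat_pow : Primrec₂ ((· ^ ·) : ℕ → ℕ → ℕ) :=
  Primrec₂.unpaired'.1 Nat.Primrec.pow

theorem primrec_binaryStrings : Primrec binaryStrings := by
  unfold binaryStrings
  refine Primrec.nat_rec₁ _ ?_
  have h : ∀ b : Bool, Primrec fun p : ℕ × List (List Bool) => p.2.map (List.cons b) := fun b =>
    Primrec.list_map Primrec.snd (Primrec.list_cons.comp (Primrec.const b) Primrec.snd)
  exact Primrec.list_append.comp (h true) (h false)

theorem primrec_bit {α : Type*} [Primcodable α] {f : α → List Bool} {g : α → ℕ}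
    (hf : Primrec f) (hg : Primrec g) : Primrec fun a => (f a).getD (g a) false :=
  (Primrec.list_getD false).comp hf hg

theorem primrec_xorString :
    Primrec fun q : ℕ × List Bool × List Bool => xorString q.1 q.2.1 q.2.2 := by
  unfold xorString
  refine Primrec.list_map (Primrec.list_range.comp Primrec.fst) ?_
  exact (Primrec.dom_bool₂ xor).comp
    (primrec_bit (Primrec.fst.comp (Primrec.snd.comp Primrec.fst)) Primrec.snd)
    (primrec_bit (Primrec.snd.comp (Primrec.snd.comp Primrec.fst)) Primrec.snd)

theorem primrec_commonOnes :
    Primrec fun q : ℕ × List Bool × List Bool => commonOnes q.1 q.2.1 q.2.2 := by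
  unfold commonOnes
  refine Primrec.filter_length (Primrec.list_range.comp Primrec.fst)
    
    (p := fun (q : ℕ × List Bool × List Bool) i =>
      (q.2.1.getD i false && q.2.2.getD i false) = true) ?_
  exact Primrec.eq.comp (Primrec.and.comp
    (primrec_bit (Primrec.fst.comp (Primrec.snd.comp Primrec.fst)) Primrec.snd)
    (primrec_bit (Primrec.snd.comp (Primrec.snd.comp Primrec.fst)) Primrec.snd))
    (Primrec.const true)

theorem primrecPred_balancedAt :
    PrimrecPred fun q : ((ℕ × ℕ) × List (List Bool)) × List Bool =>
      BalancedAt q.1.1.1 q.1.1.2 q.1.2 q.2 := by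
  have hn : Primrec fun q : ((ℕ × ℕ) × List (List Bool)) × List Bool => q.1.1.1 :=
    Primrec.fst.comp (Primrec.fst.comp Primrec.fst)
  have hL : Primrec fun q : ((ℕ × ℕ) × List (List Bool)) × List Bool => q.1.1.2 :=
    Primrec.snd.comp (Primrec.fst.comp Primrec.fst)
  have hA : Primrec fun q : ((ℕ × ℕ) × List (List Bool)) × List Bool => q.1.2 :=
    Primrec.snd.comp Primrec.fst
  have hl := Primrec.list_length.comp hA
  have ht : Primrec fun q : ((ℕ × ℕ) × List (List Bool)) × List Bool =>
      (q.1.2.filter fun a => commonOnes q.1.1.1 q.2 a % 2 = 1).length := by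
    have hc : Primrec fun r : (((ℕ × ℕ) × List (List Bool)) × List Bool) × List Bool =>
        commonOnes r.1.1.1.1 r.1.2 r.2 :=
      primrec_commonOnes.comp (Primrec.pair (hn.comp Primrec.fst)
        (Primrec.pair (Primrec.snd.comp Primrec.fst) Primrec.snd))
    exact Primrec.filter_length hA
      (p := fun (q : ((ℕ × ℕ) × List (List Bool)) × List Bool) a =>
        commonOnes q.1.1.1 q.2 a % 2 = 1)
      (Primrec.eq.comp (Primrec.nat_mod.comp hc (Primrec.const 2)) (Primrec.const 1))
  have h2 := Primrec.nat_mul.comp hL (Primrec.nat_mul.comp (Primrec.const 2) ht)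
  have h1 := Primrec.nat_mul.comp hL hl
  exact (Primrec.nat_le.comp h1 (Primrec.nat_add.comp h2 hl)).and
    (Primrec.nat_le.comp h2 (Primrec.nat_add.comp h1 hl))

theorem primrecPred_balancedList :
    PrimrecPred fun q : (ℕ × ℕ) × List (List Bool) => BalancedList q.1.1 q.1.2 q.2 := by
  have hn : Primrec fun q : (ℕ × ℕ) × List (List Bool) => q.1.1 := Primrec.fst.comp Primrec.fst
  have hL : Primrec fun q : (ℕ × ℕ) × List (List Bool) => q.1.2 := Primrec.snd.comp Primrec.fst
  refine PrimrecPred.and ?_ ?_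
  · exact Primrec.eq.comp (Primrec.list_length.comp Primrec.snd)
      (Primrec.nat_mul.comp (Primrec.nat_mul.comp (Primrec.const 2) (Primrec.succ.comp hn))
        (primrec_nat_pow.comp hL (Primrec.const 2)))
  · refine PrimrecPred.forall_mem (primrec_binaryStrings.comp hn)
      (p := fun q c => (∃ b ∈ c, b = true) → BalancedAt q.1.1 q.1.2 q.2 c) ?_
    have h1 : PrimrecPred fun q : ((ℕ × ℕ) × List (List Bool)) × List Bool =>
        ∃ b ∈ q.2, b = true :=
      PrimrecPred.exists_mem Primrec.snd (p := fun _ b => b = true)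
        (Primrec.eq.comp Primrec.snd (Primrec.const true))
    exact (h1.not.or primrecPred_balancedAt).of_eq fun q => imp_iff_not_or.symm

/-- The list of strings with a given code. -/
def decodeStrings (k : ℕ) : List (List Bool) := (Encodable.decode k).getD []

theorem primrec_decodeStrings : Primrec decodeStrings :=
  Primrec.option_getD.comp Primrec.decode (Primrec.const [])

/-- The test whether the list with code `k` is balanced. -/
def balancedTest (q : ℕ × ℕ) (k : ℕ) : Bool := decide (BalancedList q.1 q.2 (decodeStrings k))

theorem computable_balancedTest : Computable₂ balancedTest := by
  have h : PrimrecPred fun q : (ℕ × ℕ) × ℕ => BalancedList q.1.1 q.1.2 (decodeStrings q.2) :=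
    primrecPred_balancedList.comp
      (Primrec.pair Primrec.fst (primrec_decodeStrings.comp Primrec.snd))
  exact h.decide.to_comp

theorem exists_balancedTest (q : ℕ × ℕ) : ∃ k, balancedTest q k = true := by
  obtain ⟨A, hA⟩ := exists_balancedList q.1 q.2
  exact ⟨Encodable.encode A, by
    rwa [balancedTest, decodeStrings, Encodable.encodek, decide_eq_true_eq]⟩

/-- The balanced list with the least code. -/
def leastBalancedList (q : ℕ × ℕ) : List (List Bool) :=
  decodeStrings (Nat.find (exists_balancedTest q))

theorem balancedList_leastBalancedList (n L : ℕ) : BalancedList n L (leastBalancedList (n, L)) :=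
  of_decide_eq_true (Nat.find_spec (exists_balancedTest (n, L)))

theorem computable_leastBalancedList : Computable leastBalancedList := by
  refine primrec_decodeStrings.to_comp.comp ?_
  have h : Partrec fun q => Nat.rfind fun k => Part.some (balancedTest q k) :=
    Partrec.rfind computable_balancedTest.partrec₂
  refine h.of_eq_tot fun q => Nat.mem_rfind.2 ⟨?_, fun {m} hm => ?_⟩
  · rw [Nat.find_spec (exists_balancedTest q)]
    exact Part.mem_some true
  · rw [Bool.eq_false_iff.2 (Nat.find_min (exists_balancedTest q) hm)]
    exact Part.mem_some false

/-! ### Enumerating the members of semidecidable families of bounded size -/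

section Enumeration

variable {α β : Type} [DecidableEq β]

/-- The test whether `x` does not occur in `l`. -/
def isFresh (x : β) (l : List β) : Bool := !decide (x ∈ l)

theorem isFresh_eq_true {x : β} {l : List β} : isFresh x l = true ↔ x ∉ l := by
  simp [isFresh]

theorem isFresh_eq_false {x : β} {l : List β} : isFresh x l = false ↔ x ∈ l := by
  simp [isFresh]

variable [Primcodable β]

theorem primrec_isFresh : Primrec₂ (isFresh (β := β)) := by
  have h : PrimrecPred fun q : β × List β => ∃ y ∈ q.2, y = q.1 :=
    PrimrecPred.exists_mem Primrec.snd (p := fun (q : β × List β) y => y = q.1)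
      (Primrec.eq.comp Primrec.snd (Primrec.fst.comp Primrec.fst))
  have h' : PrimrecPred fun q : β × List β => q.1 ∈ q.2 := h.of_eq fun q => by simp
  exact Primrec.not.comp h'.decide

/-- One step in listing without repetition the strings that are found by the test `r`. -/
def enumStep (r : α → β × ℕ → Bool) (a : α) (t : ℕ) (l : List β) : List β :=
  match (Encodable.decode t : Option (β × ℕ)) with
  | none => l
  | some w => bif r a w && isFresh w.1 l then l ++ [w.1] else l

/-- The members found by the test `r` with witnesses of code less than `t`, in order of
appearance. -/
def enumUpTo (r : α → β × ℕ → Bool) (a : α) (t : ℕ) : List β :=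
  Nat.rec [] (fun t l => enumStep r a t l) t

theorem enumUpTo_succ (r : α → β × ℕ → Bool) (a : α) (t : ℕ) :
    enumUpTo r a (t + 1) = enumStep r a t (enumUpTo r a t) := rfl

theorem enumStep_cases (r : α → β × ℕ → Bool) (a : α) (t : ℕ) (l : List β) :
    enumStep r a t l = l ∨ ∃ x s, r a (x, s) = true ∧ x ∉ l ∧ enumStep r a t l = l ++ [x] := by
  unfold enumStep
  rcases h : (Encodable.decode t : Option (β × ℕ)) with _ | ⟨x, s⟩
  · exact Or.inl rfl
  · by_cases hr : r a (x, s) = true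
    · by_cases hx : x ∈ l
      · exact Or.inl (by simp [isFresh_eq_false.2 hx])
      · exact Or.inr ⟨x, s, hr, hx, by simp [hr, isFresh_eq_true.2 hx]⟩
    · exact Or.inl (by simp [hr])

theorem nodup_enumUpTo (r : α → β × ℕ → Bool) (a : α) (t : ℕ) : (enumUpTo r a t).Nodup := by
  induction t with
  | zero => exact List.nodup_nil
  | succ t ih =>
    rw [enumUpTo_succ]
    rcases enumStep_cases r a t (enumUpTo r a t) with h | ⟨x, s, -, hx, h⟩ <;> rw [h]
    · exact ih
    · exact List.nodup_append.2 ⟨ih, by simp, by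
        intro y hy z hz; rw [List.mem_singleton.1 hz]; rintro rfl; exact hx hy⟩

theorem exists_witness_of_mem_enumUpTo (r : α → β × ℕ → Bool) (a : α) (t : ℕ) {x : β}
    (hx : x ∈ enumUpTo r a t) : ∃ s, r a (x, s) = true := by
  induction t with
  | zero => exact absurd hx List.not_mem_nil
  | succ t ih =>
    rw [enumUpTo_succ] at hx
    rcases enumStep_cases r a t (enumUpTo r a t) with h | ⟨y, s, hy, -, h⟩ <;> rw [h] at hx
    · exact ih hx
    · rcases List.mem_append.1 hx with hx | hx
      · exact ih hx
      · exact ⟨s, by rwa [List.mem_singleton.1 hx]⟩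

/-- Elements are only ever appended, so an index once assigned keeps its element; this makes
`enumNth` independent of the stage at which it is read. -/
theorem enumUpTo_prefix (r : α → β × ℕ → Bool) (a : α) {t u : ℕ} (h : t ≤ u) :
    enumUpTo r a t <+: enumUpTo r a u := by
  induction u, h using Nat.le_induction with
  | base => exact List.prefix_rfl
  | succ u _ ih =>
    rw [enumUpTo_succ]
    rcases enumStep_cases r a u (enumUpTo r a u) with h | ⟨y, s, -, -, h⟩ <;> rw [h]
    · exact ih
    · exact ih.trans (List.prefix_append _ _)

theorem mem_enumUpTo_of_witness (r : α → β × ℕ → Bool) (a : α) {x : β} {s : ℕ}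
    (h : r a (x, s) = true) : x ∈ enumUpTo r a (Encodable.encode (x, s) + 1) := by
  rw [enumUpTo_succ]
  unfold enumStep
  rw [Encodable.encodek]
  by_cases hx : x ∈ enumUpTo r a (Encodable.encode (x, s))
  · simp only [isFresh_eq_false.2 hx, Bool.and_false, cond_false, hx]
  · simp only [h, isFresh_eq_true.2 hx, Bool.and_true, cond_true, List.mem_append,
      List.mem_singleton, or_true]

theorem computable_enumUpTo [Primcodable α] {r : α → β × ℕ → Bool} (hr : Computable₂ r) :
    Computable₂ (enumUpTo r) := by
  have hstep : Computable fun q : (α × ℕ × List β) × β × ℕ =>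
      bif r q.1.1 q.2 && isFresh q.2.1 q.1.2.2 then q.1.2.2 ++ [q.2.1] else q.1.2.2 := by
    have hl : Computable fun q : (α × ℕ × List β) × β × ℕ => q.1.2.2 :=
      Computable.snd.comp (Computable.snd.comp Computable.fst)
    have hx : Computable fun q : (α × ℕ × List β) × β × ℕ => q.2.1 :=
      Computable.fst.comp Computable.snd
    have hmem : Computable fun q : (α × ℕ × List β) × β × ℕ => isFresh q.2.1 q.1.2.2 :=
      primrec_isFresh.to_comp.comp hx hl
    have htest : Computable fun q : (α × ℕ × List β) × β × ℕ => r q.1.1 q.2 :=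
      hr.comp (Computable.fst.comp Computable.fst) Computable.snd
    have happ : Computable fun q : (α × ℕ × List β) × β × ℕ => q.1.2.2 ++ [q.2.1] :=
      Computable.list_concat.comp hl hx
    exact Computable.cond (Primrec.and.to_comp.comp htest hmem) happ hl
  have h : Computable₂ fun (a : α) (p : ℕ × List β) => enumStep r a p.1 p.2 := by
    refine (Computable.option_casesOn (o := fun q : α × ℕ × List β =>
      (Encodable.decode q.2.1 : Option (β × ℕ)))
      (Computable.decode.comp (Computable.fst.comp Computable.snd))
      (Computable.snd.comp Computable.snd) hstep.to₂).of_eq fun q => ?_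
    dsimp only [enumStep]
    rcases (Encodable.decode q.2.1 : Option (β × ℕ)) with _ | w <;> rfl
  have h' : Computable₂ fun (q : α × ℕ) (p : ℕ × List β) => enumStep r q.1 p.1 p.2 :=
    h.comp (Computable.fst.comp Computable.fst) Computable.snd
  exact Computable.nat_rec (f := fun q : α × ℕ => q.2) (g := fun _ => []) Computable.snd
    (Computable.const []) h'

/-- The `i`-th element of the family of sets semidecided by `r`. -/
def enumNth (r : α → β × ℕ → Bool) (a : α) (i : ℕ) : Part β :=
  Nat.rfindOpt fun t => (enumUpTo r a t)[i]?

theorem partrec_enumNth [Primcodable α] {r : α → β × ℕ → Bool} (hr : Computable₂ r) :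
    Partrec fun q : α × ℕ => enumNth r q.1 q.2 := by
  refine Partrec.rfindOpt ?_
  exact Computable.list_getElem?.comp
    ((computable_enumUpTo hr).comp (Computable.fst.comp Computable.fst) Computable.snd)
    (Computable.snd.comp Computable.fst)

/-- A member of a semidecidable set with at most `N` elements is the `i`-th for some `i < N`. -/
theorem exists_mem_enumNth (r : α → β × ℕ → Bool) (a : α) (N : ℕ)
    (hN : ∀ F : Finset β, (∀ x ∈ F, ∃ s, r a (x, s) = true) → F.card ≤ N) {x : β} {s : ℕ}
    (h : r a (x, s) = true) : ∃ i < N, x ∈ enumNth r a i := by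
  obtain ⟨i, hi, hx⟩ := List.mem_iff_getElem.1 (mem_enumUpTo_of_witness r a h)
  set T := Encodable.encode (x, s) + 1
  refine ⟨i, hi.trans_le ?_, ?_⟩
  -- The list has no repetitions and all its members are witnessed, so `hN` bounds its length and
  -- hence the index.
  · rw [← List.toFinset_card_of_nodup (nodup_enumUpTo r a T)]
    exact hN _ fun y hy => exists_witness_of_mem_enumUpTo r a T (List.mem_toFinset.1 hy)
  · refine (Nat.rfindOpt_mono ?_).2 ⟨T, ?_⟩
    · intro y t u htu hy
      have hy' : (enumUpTo r a t)[i]? = some y := hy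
      obtain ⟨h1, h2⟩ := List.getElem?_eq_some_iff.1 hy'
      show (enumUpTo r a u)[i]? = some y
      rw [List.prefix_iff_getElem?.1 (enumUpTo_prefix r a htu) i h1, h2]
    · show (enumUpTo r a T)[i]? = some x
      rw [List.getElem?_eq_getElem hi, hx]

end Enumeration

/-! ### Strings of bounded complexity -/

/-- Universality excludes the case of an empty set of lengths, whose infimum would be 0 without any
program. -/
theorem IsUniversal.kolmogorov_le_iff {U : Machine} (hU : IsUniversal U) {y : List Bool} {k : ℕ} :
    kolmogorov U y ≤ k ↔ ∃ p : List Bool, y ∈ U p ∧ p.length ≤ k := by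
  constructor
  · intro h
    obtain ⟨p, hp, hl⟩ := hU.exists_shortest y
    exact ⟨p, hp, hl.trans_le h⟩
  · rintro ⟨p, hp, hl⟩
    exact (Nat.sInf_le ⟨p, hp, rfl⟩ : kolmogorov U y ≤ p.length).trans hl

/-- These strings are the outputs of the fewer than 2^(k+1) programs of length at most k. -/
theorem IsUniversal.exists_finset_kolmogorov_le {U : Machine} (hU : IsUniversal U) (k : ℕ) :
    ∃ B : Finset (List Bool), (∀ y, y ∈ B ↔ kolmogorov U y ≤ k) ∧ B.card ≤ 2 ^ (k + 1) := by
  classical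
  let P := (Finset.range (k + 1)).biUnion fun i => (binaryStrings i).toFinset
  have hP : ∀ p, p ∈ P ↔ p.length ≤ k := by
    intro p
    simp [P, mem_binaryStrings]
  have hPcard : P.card ≤ 2 ^ (k + 1) := by
    calc P.card ≤ ∑ i ∈ Finset.range (k + 1), (binaryStrings i).toFinset.card :=
          Finset.card_biUnion_le
      _ ≤ ∑ i ∈ Finset.range (k + 1), 2 ^ i := Finset.sum_le_sum fun i _ =>
          (List.toFinset_card_le _).trans_eq (length_binaryStrings i)
      _ ≤ 2 ^ (k + 1) := (Nat.geomSum_lt le_rfl fun i hi => Finset.mem_range.1 hi).le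
  let g : List Bool → List Bool := fun p => if h : (U p).Dom then (U p).get h else []
  refine ⟨(P.filter fun p => (U p).Dom).image g, fun y => ?_,
    Finset.card_image_le.trans ((Finset.card_filter_le _ _).trans hPcard)⟩
  rw [hU.kolmogorov_le_iff, Finset.mem_image]
  constructor
  · rintro ⟨p, hp, rfl⟩
    obtain ⟨hp, hd⟩ := Finset.mem_filter.1 hp
    refine ⟨p, ?_, (hP p).1 hp⟩
    simp only [g, hd, dif_pos]
    exact Part.get_mem hd
  · rintro ⟨p, ⟨hd, rfl⟩, hl⟩
    exact ⟨p, Finset.mem_filter.2 ⟨(hP p).2 hl, hd⟩, by simp [g, hd]⟩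

/-- The length of the string with a given code. -/
def decodeLength (q : ℕ) : ℕ := ((Encodable.decode q : Option (List Bool)).getD []).length

theorem primrec_decodeLength : Primrec decodeLength :=
  Primrec.list_length.comp (Primrec.option_getD.comp Primrec.decode (Primrec.const []))

/-- Within `s` steps, some program of length at most `k` is found to produce `y`. -/
def Found (c : Nat.Partrec.Code) (k s : ℕ) (y : List Bool) : Prop :=
  ∃ q ∈ List.range s, decodeLength q ≤ k ∧ c.evaln s q = some (Encodable.encode y)

instance (c : Nat.Partrec.Code) (k s : ℕ) (y : List Bool) : Decidable (Found c k s y) :=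
  inferInstanceAs (Decidable (∃ q ∈ List.range s, _))

theorem primrecPred_found (c : Nat.Partrec.Code) :
    PrimrecPred fun r : (ℕ × ℕ) × List Bool => Found c r.1.1 r.1.2 r.2 := by
  have hk : Primrec fun r : ((ℕ × ℕ) × List Bool) × ℕ => r.1.1.1 :=
    Primrec.fst.comp (Primrec.fst.comp Primrec.fst)
  have hs : Primrec fun r : ((ℕ × ℕ) × List Bool) × ℕ => r.1.1.2 :=
    Primrec.snd.comp (Primrec.fst.comp Primrec.fst)
  have he : Primrec fun r : ((ℕ × ℕ) × List Bool) × ℕ => c.evaln r.1.1.2 r.2 :=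
    Nat.Partrec.Code.primrec_evaln.comp
      (Primrec.pair (Primrec.pair hs (Primrec.const c)) Primrec.snd)
  have hy : Primrec fun r : ((ℕ × ℕ) × List Bool) × ℕ => some (Encodable.encode r.1.2) :=
    Primrec.option_some.comp (Primrec.encode.comp (Primrec.snd.comp Primrec.fst))
  have hl : Primrec fun r : ((ℕ × ℕ) × List Bool) × ℕ => decodeLength r.2 :=
    primrec_decodeLength.comp Primrec.snd
  exact PrimrecPred.exists_mem (Primrec.list_range.comp (Primrec.snd.comp Primrec.fst))
    (p := fun (r : (ℕ × ℕ) × List Bool) q =>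
      decodeLength q ≤ r.1.1 ∧ c.evaln r.1.2 q = some (Encodable.encode r.2))
    ((Primrec.nat_le.comp hl hk).and (Primrec.eq.comp he hy))

theorem Found.mono {c : Nat.Partrec.Code} {k s t : ℕ} {y : List Bool} (hst : s ≤ t)
    (h : Found c k s y) : Found c k t y := by
  obtain ⟨q, hq, hl, he⟩ := h
  exact ⟨q, List.mem_range.2 ((List.mem_range.1 hq).trans_le hst), hl,
    Nat.Partrec.Code.evaln_mono hst he⟩

/-- `c` is a code for the machine `U`. -/
def IsCodeOf (c : Nat.Partrec.Code) (U : Machine) : Prop :=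
  c.eval = fun n => Part.bind (Encodable.decode (α := List Bool) n) fun p =>
    (U p).map Encodable.encode

theorem IsCodeOf.mem_eval_iff {c : Nat.Partrec.Code} {U : Machine} (hc : IsCodeOf c U) (q : ℕ)
    (y : List Bool) : Encodable.encode y ∈ c.eval q ↔
      ∃ p, Encodable.decode (α := List Bool) q = some p ∧ y ∈ U p := by
  rw [hc]
  simp [Part.mem_bind_iff]

/-- Makes upper bounds on complexity semidecidable: dovetail over programs and running times. -/
theorem IsCodeOf.exists_found_iff {c : Nat.Partrec.Code} {U : Machine} (hc : IsCodeOf c U)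
    (hU : IsUniversal U) {k : ℕ} {y : List Bool} :
    (∃ s, Found c k s y) ↔ kolmogorov U y ≤ k := by
  rw [hU.kolmogorov_le_iff]
  constructor
  · rintro ⟨s, q, -, hl, he⟩
    obtain ⟨p, hp, hy⟩ := (hc.mem_eval_iff q y).1 (Nat.Partrec.Code.evaln_sound he)
    exact ⟨p, hy, by simpa [decodeLength, hp] using hl⟩
  · rintro ⟨p, hp, hl⟩
    obtain ⟨s, hs⟩ := Nat.Partrec.Code.evaln_complete.1
      ((hc.mem_eval_iff (Encodable.encode p) y).2 ⟨p, Encodable.encodek p, hp⟩)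
    exact ⟨s, Encodable.encode p, List.mem_range.2 (Nat.Partrec.Code.evaln_bound hs),
      by simpa [decodeLength] using hl, hs⟩

/-! ### Strings with many simple translates -/

/-- The list of translation vectors for strings of length `n`. The proportion `1 / (m + 1)` is the
one of interest, and `d` controls the quality. -/
def translations (d m n : ℕ) : List (List Bool) :=
  leastBalancedList (n, 2 ^ (d + 2) * (m + 1) ^ 2)

theorem balancedList_translations (d m n : ℕ) :
    BalancedList n (2 ^ (d + 2) * (m + 1) ^ 2) (translations d m n) :=
  balancedList_leastBalancedList _ _

theorem computable_translations : Computable fun q : (ℕ × ℕ) × ℕ =>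
    translations q.1.1 q.1.2 q.2 := by
  have hL : Primrec fun q : (ℕ × ℕ) × ℕ => 2 ^ (q.1.1 + 2) * (q.1.2 + 1) ^ 2 :=
    Primrec.nat_mul.comp
      (primrec_nat_pow.comp (Primrec.const 2)
        (Primrec.nat_add.comp (Primrec.fst.comp Primrec.fst) (Primrec.const 2)))
      (primrec_nat_pow.comp (Primrec.succ.comp (Primrec.snd.comp Primrec.fst)) (Primrec.const 2))
  exact computable_leastBalancedList.comp (Computable.snd.pair hL.to_comp)

/-- The test whether, within `s` steps, a proportion of at least `1 / (m + 1)` of the translates of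
`x` by `A` is found to have complexity at most `k`. -/
def ManySimple (c : Nat.Partrec.Code) (A : List (List Bool)) (k m s : ℕ) (x : List Bool) : Prop :=
  2 ^ (k + 1) * (2 * (m + 1)) ≤ 2 ^ x.length ∧
    A.length ≤ (m + 1) * (A.filter fun a => Found c k s (xorString x.length x a)).length

instance (c : Nat.Partrec.Code) (A : List (List Bool)) (k m s : ℕ) (x : List Bool) :
    Decidable (ManySimple c A k m s x) :=
  inferInstanceAs (Decidable (_ ∧ _))

theorem primrecPred_manySimple (c : Nat.Partrec.Code) :
    PrimrecPred fun r : List (List Bool) × (ℕ × ℕ × ℕ) × List Bool =>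
      ManySimple c r.1 r.2.1.1 r.2.1.2.1 r.2.1.2.2 r.2.2 := by
  have hk : Primrec fun r : List (List Bool) × (ℕ × ℕ × ℕ) × List Bool => r.2.1.1 :=
    Primrec.fst.comp (Primrec.fst.comp Primrec.snd)
  have hm : Primrec fun r : List (List Bool) × (ℕ × ℕ × ℕ) × List Bool => r.2.1.2.1 :=
    Primrec.fst.comp (Primrec.snd.comp (Primrec.fst.comp Primrec.snd))
  have hs : Primrec fun r : List (List Bool) × (ℕ × ℕ × ℕ) × List Bool => r.2.1.2.2 :=
    Primrec.snd.comp (Primrec.snd.comp (Primrec.fst.comp Primrec.snd))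
  have hx : Primrec fun r : List (List Bool) × (ℕ × ℕ × ℕ) × List Bool => r.2.2 :=
    Primrec.snd.comp Primrec.snd
  have hn : Primrec fun r : List (List Bool) × (ℕ × ℕ × ℕ) × List Bool => r.2.2.length :=
    Primrec.list_length.comp hx
  have hxor : Primrec fun r : (List (List Bool) × (ℕ × ℕ × ℕ) × List Bool) × List Bool =>
      xorString r.1.2.2.length r.1.2.2 r.2 :=
    primrec_xorString.comp ((hn.comp Primrec.fst).pair ((hx.comp Primrec.fst).pair Primrec.snd))
  have hfound : PrimrecPred fun r : (List (List Bool) × (ℕ × ℕ × ℕ) × List Bool) × List Bool =>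
      Found c r.1.2.1.1 r.1.2.1.2.2 (xorString r.1.2.2.length r.1.2.2 r.2) :=
    (primrecPred_found c).comp (((hk.comp Primrec.fst).pair (hs.comp Primrec.fst)).pair hxor)
  have hcount : Primrec fun r : List (List Bool) × (ℕ × ℕ × ℕ) × List Bool =>
      (r.1.filter fun a => Found c r.2.1.1 r.2.1.2.2 (xorString r.2.2.length r.2.2 a)).length :=
    Primrec.filter_length Primrec.fst
      (p := fun (r : List (List Bool) × (ℕ × ℕ × ℕ) × List Bool) a =>
        Found c r.2.1.1 r.2.1.2.2 (xorString r.2.2.length r.2.2 a)) hfound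
  have hm1 : Primrec fun r : List (List Bool) × (ℕ × ℕ × ℕ) × List Bool => r.2.1.2.1 + 1 :=
    Primrec.succ.comp hm
  have h1 : Primrec fun r : List (List Bool) × (ℕ × ℕ × ℕ) × List Bool =>
      2 ^ (r.2.1.1 + 1) * (2 * (r.2.1.2.1 + 1)) :=
    Primrec.nat_mul.comp (primrec_nat_pow.comp (Primrec.const 2) (Primrec.succ.comp hk))
      (Primrec.nat_mul.comp (Primrec.const 2) hm1)
  have h2 : Primrec fun r : List (List Bool) × (ℕ × ℕ × ℕ) × List Bool => 2 ^ r.2.2.length :=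
    primrec_nat_pow.comp (Primrec.const 2) hn
  exact (Primrec.nat_le.comp h1 h2).and
    (Primrec.nat_le.comp (Primrec.list_length.comp Primrec.fst) (Primrec.nat_mul.comp hm1 hcount))

/-- The test `ManySimple` as a Boolean function. -/
def manySimpleTest (c : Nat.Partrec.Code)
    (r : List (List Bool) × (ℕ × ℕ × ℕ) × List Bool) : Bool :=
  decide (ManySimple c r.1 r.2.1.1 r.2.1.2.1 r.2.1.2.2 r.2.2)

theorem primrec_manySimpleTest (c : Nat.Partrec.Code) : Primrec (manySimpleTest c) :=
  (primrecPred_manySimple c).decide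

/-- The test `ManySimple` for the translation vectors with parameter `d`. The number `w` codes the
proportion and the number of steps. -/
def badTest (c : Nat.Partrec.Code) (a : ℕ × ℕ) (w : List Bool × ℕ) : Bool :=
  manySimpleTest c (translations a.1 w.2.unpair.1 w.1.length,
    (a.2, w.2.unpair.1, w.2.unpair.2), w.1)

theorem computable_badTest (c : Nat.Partrec.Code) : Computable₂ (badTest c) := by
  have hm : Computable fun r : (ℕ × ℕ) × List Bool × ℕ => r.2.2.unpair.1 :=
    Computable.fst.comp (Computable.unpair.comp (Computable.snd.comp Computable.snd))
  have hs : Computable fun r : (ℕ × ℕ) × List Bool × ℕ => r.2.2.unpair.2 :=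
    Computable.snd.comp (Computable.unpair.comp (Computable.snd.comp Computable.snd))
  have hx : Computable fun r : (ℕ × ℕ) × List Bool × ℕ => r.2.1 :=
    Computable.fst.comp Computable.snd
  have hd : Computable fun r : (ℕ × ℕ) × List Bool × ℕ => r.1.1 :=
    Computable.fst.comp Computable.fst
  have hk : Computable fun r : (ℕ × ℕ) × List Bool × ℕ => r.1.2 :=
    Computable.snd.comp Computable.fst
  have hA : Computable fun r : (ℕ × ℕ) × List Bool × ℕ =>
      translations r.1.1 r.2.2.unpair.1 r.2.1.length := by
    have h := computable_translations.comp ((hd.pair hm).pair (Computable.list_length.comp hx))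
    exact h
  have hkms : Computable fun r : (ℕ × ℕ) × List Bool × ℕ =>
      (r.1.2, r.2.2.unpair.1, r.2.2.unpair.2) := hk.pair (hm.pair hs)
  have hall : Computable fun r : (ℕ × ℕ) × List Bool × ℕ =>
      (translations r.1.1 r.2.2.unpair.1 r.2.1.length,
        (r.1.2, r.2.2.unpair.1, r.2.2.unpair.2), r.2.1) := hA.pair (hkms.pair hx)
  exact (primrec_manySimpleTest c).to_comp.comp hall

/-- Compares with the telescoping series of 1/(m+1) - 1/(m+2); it bounds the union over all
proportions 1/(m+1). -/
theorem sum_inv_sq_le_two (M : ℕ) :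
    ∑ m ∈ Finset.range M, (((m : ℝ) + 1) ^ 2)⁻¹ ≤ 2 := by
  have h : ∀ M : ℕ, ∑ m ∈ Finset.range (M + 1), (((m : ℝ) + 1) ^ 2)⁻¹ ≤
      2 - 1 / ((M : ℝ) + 1) := by
    intro M
    induction M with
    | zero => norm_num
    | succ M ih =>
      rw [Finset.sum_range_succ]
      have hM : (0 : ℝ) ≤ M := Nat.cast_nonneg M
      have h : ((((M + 1 : ℕ) : ℝ) + 1) ^ 2)⁻¹ ≤
          1 / ((M : ℝ) + 1) - 1 / (((M + 1 : ℕ) : ℝ) + 1) := by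
        push_cast
        rw [div_sub_div _ _ (by positivity) (by positivity), ← one_div,
          div_le_div_iff₀ (by positivity) (by positivity)]
        nlinarith
      linarith
  have hpos : (0 : ℝ) ≤ 1 / ((M : ℝ) + 1) := by positivity
  have hmono : ∑ m ∈ Finset.range M, (((m : ℝ) + 1) ^ 2)⁻¹ ≤
      ∑ m ∈ Finset.range (M + 1), (((m : ℝ) + 1) ^ 2)⁻¹ := by
    rw [Finset.sum_range_succ]
    exact le_add_of_nonneg_right (by positivity)
  linarith [h M]

/-- Few strings have, for some `m`, a proportion of at least `1 / (m + 1)` of translates of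
complexity at most `k`. -/
theorem IsCodeOf.card_mul_le {c : Nat.Partrec.Code} {U : Machine} (hc : IsCodeOf c U)
    (hU : IsUniversal U) (d k : ℕ) (F : Finset (List Bool))
    (hF : ∀ x ∈ F, ∃ w, badTest c (d, k) (x, w) = true) : F.card * 4 ^ d ≤ 2 ^ k := by
  classical
  obtain ⟨B, hB, hBcard⟩ := hU.exists_finset_kolmogorov_le k
  -- Replacing the time-bounded search by true membership in `B` only enlarges the set of bad
  -- strings and leaves m as the sole parameter of the witness.
  let Hit : ℕ → List Bool → Prop := fun m x => 2 ^ (k + 1) * (2 * (m + 1)) ≤ 2 ^ x.length ∧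
    (translations d m x.length).length ≤ (m + 1) * ((translations d m x.length).filter fun a =>
      xorString x.length x a ∈ B).length
  have hhit : ∀ x ∈ F, ∃ m, Hit m x := by
    intro x hx
    obtain ⟨w, hw⟩ := hF x hx
    obtain ⟨h1, h2⟩ : ManySimple c _ _ _ _ _ := of_decide_eq_true hw
    refine ⟨w.unpair.1, h1, h2.trans (Nat.mul_le_mul_left _ ?_)⟩
    rw [← List.countP_eq_length_filter, ← List.countP_eq_length_filter]
    refine List.countP_mono_left fun a _ ha => ?_
    simp only [decide_eq_true_eq] at ha ⊢
    exact (hB _).2 ((hc.exists_found_iff hU).1 ⟨_, ha⟩)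
  -- Expansion is applied at each length separately and the bounds are added. Since L² = 16 · 4^d
  -- (m+1)⁴, dividing by 4(m+1)² leaves 4^(d+1) (m+1)².
  have hlevel : ∀ m, (F.filter (Hit m)).card * (4 ^ (d + 1) * (m + 1) ^ 2) ≤ 2 ^ (k + 1) := by
    intro m
    refine le_trans ?_ hBcard
    let N := (F ∪ B).sup List.length + 1
    have hN : ∀ x ∈ F ∪ B, x.length ∈ Finset.range N := fun x hx =>
      Finset.mem_range.2 (Nat.lt_succ_of_le (Finset.le_sup (f := List.length) hx))
    rw [Finset.card_eq_sum_card_fiberwise (s := F.filter (Hit m)) (t := Finset.range N)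
        (f := List.length) fun x hx =>
          hN x (Finset.mem_union_left _ (Finset.mem_filter.1 hx).1),
      Finset.card_eq_sum_card_fiberwise (s := B) (t := Finset.range N) (f := List.length)
        fun x hx => hN x (Finset.mem_union_right _ hx), Finset.sum_mul]
    refine Finset.sum_le_sum fun n _ => ?_
    -- The density condition for length `n` is carried by any bad string of that length; if there is
    -- none, the bound is trivial.
    rcases Finset.eq_empty_or_nonempty ((F.filter (Hit m)).filter fun x => x.length = n) with
      he | ⟨x₀, hx₀⟩
    · rw [he]; simp
    have hspec : ∀ x ∈ (F.filter (Hit m)).filter fun x => x.length = n, Hit m x ∧ x.length = n :=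
      fun x hx => ⟨(Finset.mem_filter.1 (Finset.mem_filter.1 hx).1).2, (Finset.mem_filter.1 hx).2⟩
    have hmain := (balancedList_translations d m n).card_mul_sq_le (by positivity) m.succ_pos
      (B.filter fun x => x.length = n) ((F.filter (Hit m)).filter fun x => x.length = n) ?_
      (fun y hy => (Finset.mem_filter.1 hy).2) (fun x hx => (hspec x hx).2) ?_
    · have hpos : 0 < 4 * (m + 1) ^ 2 := by positivity
      refine Nat.le_of_mul_le_mul_left ?_ hpos
      refine le_trans (le_of_eq ?_) hmain
      have : (4 : ℕ) ^ (d + 1) = 4 * (2 ^ d) ^ 2 := by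
        rw [← pow_mul, mul_comm d 2, pow_mul, pow_succ]; ring
      rw [this]
      ring
    · obtain ⟨⟨h1, -⟩, hn⟩ := hspec x₀ hx₀
      rw [hn] at h1
      refine le_trans (Nat.mul_le_mul_right _ ?_) h1
      exact (Finset.card_filter_le _ _).trans hBcard
    · intro x hx
      obtain ⟨⟨-, h2⟩, hn⟩ := hspec x hx
      rw [hn] at h2
      refine h2.trans_eq ?_
      congr 2
      refine List.filter_congr fun a _ => ?_
      simp [length_xorString]
  choose! m hm using hhit
  let M := F.sup m + 1
  have hcover : F ⊆ (Finset.range M).biUnion fun i => F.filter (Hit i) := fun x hx =>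
    Finset.mem_biUnion.2 ⟨m x, Finset.mem_range.2 (Nat.lt_succ_of_le (Finset.le_sup hx)),
      Finset.mem_filter.2 ⟨hx, hm x hx⟩⟩
  have hsum : F.card ≤ ∑ i ∈ Finset.range M, (F.filter (Hit i)).card :=
    (Finset.card_le_card hcover).trans Finset.card_biUnion_le
  have hreal : (F.card : ℝ) ≤ 2 ^ (k + 1) / 4 ^ (d + 1) * 2 := by
    calc (F.card : ℝ) ≤ ∑ i ∈ Finset.range M, ((F.filter (Hit i)).card : ℝ) := by
          exact_mod_cast hsum
      _ ≤ ∑ i ∈ Finset.range M, 2 ^ (k + 1) / 4 ^ (d + 1) * (((i : ℝ) + 1) ^ 2)⁻¹ := by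
          refine Finset.sum_le_sum fun i _ => ?_
          rw [← div_eq_mul_inv, div_div, le_div_iff₀ (by positivity)]
          exact_mod_cast hlevel i
      _ = 2 ^ (k + 1) / 4 ^ (d + 1) * ∑ i ∈ Finset.range M, (((i : ℝ) + 1) ^ 2)⁻¹ := by
          rw [Finset.mul_sum]
      _ ≤ _ := by
          gcongr
          exact sum_inv_sq_le_two M
  have : (F.card : ℝ) * 4 ^ d ≤ 2 ^ k := by
    calc (F.card : ℝ) * 4 ^ d ≤ 2 ^ (k + 1) / 4 ^ (d + 1) * 2 * 4 ^ d := by gcongr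
      _ = 2 ^ k := by field_simp; ring
  exact_mod_cast this

/-! ### The machine that describes bad strings -/

/-- The number whose binary expansion, least significant bit first, is the given string. -/
def stringValue (q : List Bool) : ℕ := q.foldr (fun b v => b.toNat + 2 * v) 0

/-- Padding to length exactly `l` matters: the machine below reads the complexity bound off the
length of the index. -/
theorem exists_stringValue_eq (l i : ℕ) (hi : i < 2 ^ l) :
    ∃ q : List Bool, q.length = l ∧ stringValue q = i := by
  induction l generalizing i with
  | zero => exact ⟨[], rfl, by simp [stringValue] at hi ⊢; omega⟩
  | succ l ih =>
    obtain ⟨q, hq, hv⟩ := ih (i / 2) (by rw [pow_succ] at hi; omega)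
    refine ⟨decide (i % 2 = 1) :: q, by simp [hq], ?_⟩
    have : stringValue (decide (i % 2 = 1) :: q) =
      (decide (i % 2 = 1)).toNat + 2 * stringValue q := rfl
    rw [this, hv]
    rcases Nat.mod_two_eq_zero_or_one i with h | h <;> simp [h] <;> omega

theorem primrec_stringValue : Primrec stringValue := by
  have h : Primrec₂ fun (_ : List Bool) (p : Bool × ℕ) => p.1.toNat + 2 * p.2 :=
    Primrec.nat_add.comp
      ((Primrec.dom_finite Bool.toNat).comp (Primrec.fst.comp Primrec.snd))
      (Primrec.nat_mul.comp (Primrec.const 2) (Primrec.snd.comp Primrec.snd))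
  exact Primrec.list_foldr Primrec.id (Primrec.const 0) h

/-- On input `1 ^ d 0 q`, the machine outputs the bad string, for the parameters `d` and
`|q| + 2 d`, whose index is coded by `q`. -/
def badStringMachine (c : Nat.Partrec.Code) : Machine := fun p =>
  enumNth (badTest c)
    ((p.takeWhile id).length, (p.drop ((p.takeWhile id).length + 1)).length +
      2 * (p.takeWhile id).length)
    (stringValue (p.drop ((p.takeWhile id).length + 1)))

theorem partrec_badStringMachine (c : Nat.Partrec.Code) : Partrec (badStringMachine c) := by
  have hd : Primrec fun p : List Bool => (p.takeWhile id).length :=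
    Primrec.list_length.comp (Primrec.list_takeWhile Primrec.id)
  have hq : Primrec fun p : List Bool => p.drop ((p.takeWhile id).length + 1) :=
    Primrec.list_drop.comp (Primrec.succ.comp hd) Primrec.id
  have hk : Primrec fun p : List Bool => (p.drop ((p.takeWhile id).length + 1)).length +
      2 * (p.takeWhile id).length :=
    Primrec.nat_add.comp (Primrec.list_length.comp hq) (Primrec.nat_mul.comp (Primrec.const 2) hd)
  have h := (partrec_enumNth (computable_badTest c)).comp
    ((hd.pair hk).pair (primrec_stringValue.comp hq)).to_comp
  exact h

theorem badStringMachine_apply (c : Nat.Partrec.Code) (d : ℕ) (q : List Bool) :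
    badStringMachine c (List.replicate d true ++ false :: q) =
      enumNth (badTest c) (d, q.length + 2 * d) (stringValue q) := by
  have h1 : ((List.replicate d true ++ false :: q).takeWhile id).length = d := by
    rw [List.takeWhile_append_of_pos (by simp)]
    simp
  have h2 : (List.replicate d true ++ false :: q).drop (d + 1) = q := by
    rw [List.drop_append]
    simp
  unfold badStringMachine
  rw [h1, h2]

/-- For a suitable parameter `d`, no string has a proportion of at least `1 / (m + 1)` of
translates that are not more complex than itself. -/
theorem IsUniversal.exists_translations {U : Machine} (hU : IsUniversal U) :
    ∃ d : ℕ, ∀ (m : ℕ) (x : List Bool),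
      2 ^ (kolmogorov U x + 1) * (2 * (m + 1)) ≤ 2 ^ x.length →
      (m + 1) * ((translations d m x.length).filter fun a =>
          kolmogorov U (xorString x.length x a) ≤ kolmogorov U x).length <
        (translations d m x.length).length := by
  obtain ⟨c, hc⟩ := Nat.Partrec.Code.exists_code.1 hU.1
  have hc : IsCodeOf c U := hc
  obtain ⟨t, -, ht, e, he⟩ := hU.2 _ (partrec_badStringMachine c)
  -- With d = e + 2 the description costs (k - 2d) + (d + 1) + e = k - 1 bits, one fewer than the
  -- complexity k of `x`.
  refine ⟨e + 2, fun m x hx => ?_⟩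
  set d := e + 2 with hd
  by_contra! hbad
  -- The list is finite, so one time bound serves all its simple translates.
  have hstep : ∀ A : List (List Bool), ∃ s, ∀ a ∈ A,
      kolmogorov U (xorString x.length x a) ≤ kolmogorov U x →
        Found c (kolmogorov U x) s (xorString x.length x a) := by
    intro A
    induction A with
    | nil => exact ⟨0, by simp⟩
    | cons a A ih =>
      obtain ⟨s, hs⟩ := ih
      by_cases ha : kolmogorov U (xorString x.length x a) ≤ kolmogorov U x
      · obtain ⟨u, hu⟩ := (hc.exists_found_iff hU).2 ha
        refine ⟨max s u, fun b hb hb' => ?_⟩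
        rcases List.mem_cons.1 hb with rfl | hb
        · exact hu.mono (le_max_right _ _)
        · exact (hs b hb hb').mono (le_max_left _ _)
      · refine ⟨s, fun b hb hb' => ?_⟩
        rcases List.mem_cons.1 hb with rfl | hb
        · exact absurd hb' ha
        · exact hs b hb hb'
  obtain ⟨s, hs⟩ := hstep (translations d m x.length)
  have htest : badTest c (d, kolmogorov U x) (x, Nat.pair m s) = true := by
    unfold badTest manySimpleTest
    simp only [Nat.unpair_pair, decide_eq_true_eq]
    refine ⟨hx, hbad.trans (Nat.mul_le_mul_left _ ?_)⟩
    rw [← List.countP_eq_length_filter, ← List.countP_eq_length_filter]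
    refine List.countP_mono_left fun a ha h => ?_
    simp only [decide_eq_true_eq] at h ⊢
    exact hs a ha h
  have h4 : (4 : ℕ) ^ d = 2 ^ (2 * d) := by rw [pow_mul]; norm_num
  -- The counting bound for the single bad string `x` reads 4^d ≤ 2^k, so the subtraction k - 2d is
  -- not truncated.
  have hkd : 2 * d ≤ kolmogorov U x := by
    have h1 := hc.card_mul_le hU d (kolmogorov U x) {x} fun y hy => by
      rw [Finset.mem_singleton.1 hy]; exact ⟨_, htest⟩
    rw [Finset.card_singleton, one_mul, h4] at h1
    exact (Nat.pow_le_pow_iff_right (by norm_num)).1 h1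
  obtain ⟨i, hi, hxi⟩ := exists_mem_enumNth (badTest c) (d, kolmogorov U x)
    (2 ^ (kolmogorov U x - 2 * d)) (fun F hF => by
      have h1 := hc.card_mul_le hU d (kolmogorov U x) F hF
      rw [h4, ← Nat.sub_add_cancel hkd, pow_add] at h1
      exact Nat.le_of_mul_le_mul_right h1 (by positivity)) htest
  obtain ⟨q, hq, hv⟩ := exists_stringValue_eq _ i hi
  have hout : x ∈ U (t (List.replicate d true ++ false :: q)) := by
    rw [ht, badStringMachine_apply, hv, hq, Nat.sub_add_cancel hkd]
    exact hxi
  have hle : kolmogorov U x ≤ (t (List.replicate d true ++ false :: q)).length :=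
    hU.kolmogorov_le_iff.2 ⟨_, hout, le_rfl⟩
  have hlen := he (List.replicate d true ++ false :: q)
  simp only [List.length_append, List.length_replicate, List.length_cons, hq] at hlen
  omega

/-! ### The list of translates and the main theorem -/

theorem length_translations_le (d m n : ℕ) (hn : 0 < n) :
    (translations d m n).length ≤ n * (4 ^ (d + 3) * (m + 1) ^ 4) := by
  rw [(balancedList_translations d m n).1]
  have h : (2 ^ (d + 2) * (m + 1) ^ 2) ^ 2 = 4 ^ (d + 2) * (m + 1) ^ 4 := by
    rw [mul_pow, ← pow_mul, ← pow_mul, mul_comm (d + 2) 2, pow_mul]; norm_num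
  rw [h, pow_succ 4 (d + 2)]
  calc 2 * (n + 1) * (4 ^ (d + 2) * (m + 1) ^ 4) ≤ (n * 4) * (4 ^ (d + 2) * (m + 1) ^ 4) := by
        exact Nat.mul_le_mul_right _ (by omega)
    _ = _ := by ring

/-- The list of the translates of `x`; it is empty if `x` is empty. -/
def translateList (d : ℕ) (x : List Bool) (m : ℕ) : List (List Bool) :=
  bif decide (x.length = 0) then []
  else (translations d m x.length).map fun a => xorString x.length x a

theorem translateList_nil (d m : ℕ) : translateList d [] m = [] := rfl

theorem translateList_of_ne_nil {d : ℕ} (x : List Bool) (m : ℕ) (hx : x ≠ []) :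
    translateList d x m = (translations d m x.length).map fun a => xorString x.length x a := by
  have : decide (x.length = 0) = false := by simpa using hx
  simp only [translateList, this, cond_false]

theorem computable_translateList (d : ℕ) : Computable₂ (translateList d) := by
  have hx : Computable fun r : List Bool × ℕ => r.1.length :=
    Computable.list_length.comp Computable.fst
  have hA : Computable fun r : List Bool × ℕ => translations d r.2 r.1.length := by
    have h := computable_translations.comp (((Computable.const d).pair Computable.snd).pair hx)
    exact h
  have hxor : Primrec₂ fun (r : List Bool × List (List Bool)) (a : List Bool) =>
      xorString r.1.length r.1 a := by
    have h := primrec_xorString.comp (Primrec.pair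
      (Primrec.list_length.comp (Primrec.fst.comp
        (Primrec.fst (α := List Bool × List (List Bool)) (β := List Bool))))
      (Primrec.pair (Primrec.fst.comp Primrec.fst) Primrec.snd))
    exact h
  have hmap : Computable fun r : List Bool × List (List Bool) =>
      r.2.map fun a => xorString r.1.length r.1 a :=
    (Primrec.list_map Primrec.snd hxor).to_comp
  have hshift : Computable fun r : List Bool × ℕ =>
      (translations d r.2 r.1.length).map fun a => xorString r.1.length r.1 a := by
    have h := hmap.comp (Computable.fst.pair hA)
    exact h
  have hz : PrimrecPred fun r : List Bool × ℕ => r.1.length = 0 :=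
    Primrec.eq.comp (Primrec.list_length.comp Primrec.fst) (Primrec.const 0)
  have h := Computable.cond hz.decide.to_comp (Computable.const []) hshift
  exact h

theorem theorem2 (U : Machine) (hU : IsUniversal U) :
    ∃ f : List Bool → ℚ → List (List Bool),
      ComputableListFunction f ∧
      -- the list is a nonempty list of strings of length `|x|`
      (∀ (δ : ℚ) (x : List Bool), 0 < δ →
        (x ≠ [] → f x δ ≠ []) ∧ ∀ y ∈ f x δ, y.length = x.length) ∧
      -- the size of the list is `O(|x|) poly(1/δ)`
      (∃ P : Polynomial ℚ, ∀ (δ : ℚ) (x : List Bool), 0 < δ →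
        ((f x δ).length : ℚ) ≤ (x.length : ℚ) * P.eval (1 / δ)) ∧
      -- a `1 - δ` fraction of the list (with multiplicity) is more complex than `x`
      (∀ δ : ℚ, 0 < δ → ∃ c : ℕ, ∀ x : List Bool,
        (kolmogorov U x : ℝ) < (x.length : ℝ) - Real.logb 2 (x.length : ℝ) - (c : ℝ) →
          (1 - δ) * ((f x δ).length : ℚ) ≤
            (((f x δ).countP fun y => decide (kolmogorov U x < kolmogorov U y) : ℕ) : ℚ)) := by
  obtain ⟨d, hd⟩ := hU.exists_translations
  have hg0 := translateList_nil d
  have hg := @translateList_of_ne_nil d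
  have hgc := computable_translateList d
  generalize translateList d = g at hg0 hg hgc
  -- The choice m = ⌊1/δ⌋ gives 1/(m+1) < δ. For δ = a/b it is the natural quotient b / a, also when
  -- a or b is 0, since both divisions then give 0.
  refine ⟨fun x δ => g x ⌊1 / δ⌋₊, ?_, ?_, ?_, ?_⟩
  · have hdiv : Computable fun q : List Bool × ℕ × ℕ => q.2.2 / q.2.1 :=
      Primrec.nat_div.to_comp.comp (Computable.snd.comp Computable.snd)
        (Computable.fst.comp Computable.snd)
    have hcomp : Computable fun q : List Bool × ℕ × ℕ => g q.1 (q.2.2 / q.2.1) :=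
      hgc.comp Computable.fst hdiv
    refine hcomp.of_eq fun q => ?_
    dsimp only
    rw [one_div_div, Nat.floor_div_eq_div]
  · intro δ x _
    refine ⟨fun hx => ?_, fun y hy => ?_⟩
    · have hpos : 0 < (translations d ⌊1 / δ⌋₊ x.length).length := by
        rw [(balancedList_translations _ _ _).1]; positivity
      dsimp only
      rw [hg _ _ hx]
      exact fun h => (List.length_pos_iff.1 hpos) (List.map_eq_nil_iff.1 h)
    · rcases eq_or_ne x [] with rfl | hx
      · simp [hg0] at hy
      · dsimp only at hy
        rw [hg _ _ hx] at hy
        obtain ⟨a, -, rfl⟩ := List.mem_map.1 hy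
        exact length_xorString _ _ _
  · refine ⟨Polynomial.C (4 ^ (d + 3)) * (Polynomial.X + 1) ^ 4, fun δ x hδ => ?_⟩
    rcases eq_or_ne x [] with rfl | hx
    · simp [hg0]
    · dsimp only
      rw [hg _ _ hx, List.length_map]
      have h1 := length_translations_le d ⌊1 / δ⌋₊ x.length (List.length_pos_iff.2 hx)
      have h2 : (⌊1 / δ⌋₊ : ℚ) ≤ 1 / δ := Nat.floor_le (by positivity)
      simp only [Polynomial.eval_mul, Polynomial.eval_C, Polynomial.eval_pow, Polynomial.eval_add,
        Polynomial.eval_X, Polynomial.eval_one]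
      calc ((translations d ⌊1 / δ⌋₊ x.length).length : ℚ)
          ≤ x.length * (4 ^ (d + 3) * ((⌊1 / δ⌋₊ : ℚ) + 1) ^ 4) := by exact_mod_cast h1
        _ ≤ _ := by gcongr
  · intro δ hδ
    -- By m + 1 ≤ 2^(m+1), the density condition 2^(k+1) · 2(m+1) ≤ 2^n follows from k + m + 3 ≤ n.
    refine ⟨⌊1 / δ⌋₊ + 3, fun x hK => ?_⟩
    rcases eq_or_ne x [] with rfl | hx
    · simp [hg0]
    dsimp only
    set m := ⌊1 / δ⌋₊
    have hxl : 1 ≤ x.length := List.length_pos_iff.2 hx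
    have hlog : 0 ≤ Real.logb 2 (x.length : ℝ) :=
      Real.logb_nonneg (by norm_num) (by exact_mod_cast hxl)
    have hKn : kolmogorov U x + (m + 3) < x.length := by
      have : (kolmogorov U x : ℝ) + ((m + 3 : ℕ) : ℝ) < x.length := by linarith
      exact_mod_cast this
    have hcond : 2 ^ (kolmogorov U x + 1) * (2 * (m + 1)) ≤ 2 ^ x.length := by
      have hm : m + 1 ≤ 2 ^ (m + 1) := Nat.lt_two_pow_self.le
      calc 2 ^ (kolmogorov U x + 1) * (2 * (m + 1))
          ≤ 2 ^ (kolmogorov U x + 1) * (2 * 2 ^ (m + 1)) := by gcongr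
        _ = 2 ^ (kolmogorov U x + (m + 3)) := by ring
        _ ≤ 2 ^ x.length := Nat.pow_le_pow_right (by norm_num) hKn.le
    have hlt := hd m x hcond
    rw [hg _ _ hx, List.length_map, List.countP_map]
    set A := translations d m x.length
    have hsplit := List.length_eq_countP_add_countP
      (fun a => decide (kolmogorov U x < kolmogorov U (xorString x.length x a))) (l := A)
    rw [← List.countP_eq_length_filter] at hlt
    have hcompl : A.countP (fun a =>
        decide ¬ (decide (kolmogorov U x < kolmogorov U (xorString x.length x a))) = true) =
        A.countP fun a => decide (kolmogorov U (xorString x.length x a) ≤ kolmogorov U x) :=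
      List.countP_congr fun a _ => by simp
    rw [hcompl] at hsplit
    set bad := A.countP fun a => decide (kolmogorov U (xorString x.length x a) ≤ kolmogorov U x)
    have hfl : 1 / δ < (m : ℚ) + 1 := Nat.lt_floor_add_one _
    have hδm : 1 ≤ δ * ((m : ℚ) + 1) := by
      rw [div_lt_iff₀ hδ] at hfl
      linarith
    have hbad : (bad : ℚ) ≤ δ * A.length := by
      have h1 : ((m : ℚ) + 1) * bad ≤ A.length := by exact_mod_cast hlt.le
      calc (bad : ℚ) ≤ (δ * ((m : ℚ) + 1)) * bad := le_mul_of_one_le_left (by positivity) hδm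
        _ = δ * (((m : ℚ) + 1) * bad) := by ring
        _ ≤ δ * A.length := by gcongr
    have hs : (A.length : ℚ) = (A.countP (fun a =>
        decide (kolmogorov U x < kolmogorov U (xorString x.length x a))) : ℕ) + bad := by
      exact_mod_cast hsplit
    change _ ≤ ((A.countP (fun a =>
        decide (kolmogorov U x < kolmogorov U (xorString x.length x a))) : ℕ) : ℚ)
    linarith
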